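/- Let $H_1,H_2,H_3,H_4$ be finite-dimensional complex Hilbert spaces. Write $B(H)$ for the space of linear operators on $H$, $L(B(H),B(K))$ for the space of linear maps $B(H)\to B(K)$, and identify $B(H)\otimes B(K)$ with $B(H\otimes K)$. A linear map $\Phi:B(H)\to B(K)$ is completely positive (CP) if for every $k\in\mathbb N$ the map $\mathrm{id}_k\otimes\Phi: M_k(\mathbb C)\otimes B(H)\to M_k(\mathbb C)\otimes B(K)$ sends positive semidefinite elements to positive semidefinite elements. A super-map is a linear map $\Theta:L(B(H_1),B(H_2))\to L(B(H_3),B(H_4))$. It is called completely CP-preserving if, for all finite-dimensional Hilbert spaces $K_1,K_2$, the map $$\mathrm{id}\otimes\Theta: L(B(K_1),B(K_2))\otimes L(B(H_1),B(H_2))\to L(B(K_1),B(K_2))\otimes L(B(H_3),B(H_4))$$ sends CP maps to CP maps, where $L(B(K_1),B(K_2))\otimes L(B(H),B(H'))$ is identified with $L(B(K_1\otimes H),B(K_2\otimes H'))$. It is called a complete order isomorphism if it is invertible and both $\Theta$ and $\Theta^{-1}$ are completely CP-preserving. Fix an orthonormal basis $\{|i\rangle\}$ of $H_1$ and an orthonormal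 basis of $H_3$. Put $e_{ij}=|i\rangle\langle j|\in B(H_1)$, let $C_\Phi=\sum_{i,j}e_{ij}\otimes\Phi(e_{ij})\in B(H_1\otimes H_2)$ be the Choi matrix of $\Phi\in L(B(H_1),B(H_2))$, let $A^t$ be the transpose of $A\in B(H_3)$ with respect to the fixed basis of $H_3$, and let $\mathrm{Tr}_3:B(H_3\otimes H_4)\to B(H_4)$ be the partial trace over $H_3$. Theorem. A super-map $\Theta:L(B(H_1),B(H_2))\to L(B(H_3),B(H_4))$ is a complete order isomorphism if and only if there is an invertible linear map $K:H_1\otimes H_2\to H_3\otimes H_4$ such that $$\Theta(\Phi)(A)=\mathrm{Tr}_3\big[(A^t\otimes \mathbb I)\,K\,C_\Phi\,K^\dagger\big]\qquad\text{for all }\Phi\in L(B(H_1),B(H_2))\text{ and all }A\in B(H_3).$$ -/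

import Mathlib

open scoped TensorProduct

universe w

noncomputable section

namespace SuperMap

/-- The space `B(H)` of operators on a Hilbert space `H`. All Hilbert spaces below are
finite-dimensional, so that every linear operator is bounded. -/
abbrev Op (H : Type*) [NormedAddCommGroup H] [InnerProductSpace ℂ H] : Type _ := H →ₗ[ℂ] H

/-- The space `L(B(H), B(K))` of linear maps from `B(H)` to `B(K)`. -/
abbrev OpMap (H K : Type*) [NormedAddCommGroup H] [InnerProductSpace ℂ H]
    [NormedAddCommGroup K] [InnerProductSpace ℂ K] : Type _ := Op H →ₗ[ℂ] Op K

section Tensor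

variable (H K : Type*)
  [NormedAddCommGroup H] [InnerProductSpace ℂ H] [FiniteDimensional ℂ H]
  [NormedAddCommGroup K] [InnerProductSpace ℂ K] [FiniteDimensional ℂ K]

/-- The canonical identification `B(H) ⊗ B(K) ≃ B(H ⊗ K)`, which sends `A ⊗ B` to the operator
`x ⊗ y ↦ A x ⊗ B y`. The Hilbert space structure of `H ⊗ K` is the one of Mathlib, with
`⟪x ⊗ y, x' ⊗ y'⟫ = ⟪x, x'⟫ * ⟪y, y'⟫`. -/
def opTensor : Op H ⊗[ℂ] Op K ≃ₗ[ℂ] Op (H ⊗[ℂ] K) :=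
  homTensorHomEquiv ℂ H K H K

/-- The partial trace over the first factor, `B(H ⊗ K) → B(K)`, which sends `A ⊗ B` to
`tr(A) • B`. -/
def partialTrace : Op (H ⊗[ℂ] K) →ₗ[ℂ] Op K :=
  (TensorProduct.lid ℂ (Op K)).toLinearMap ∘ₗ
    LinearMap.rTensor (Op K) (LinearMap.trace ℂ H) ∘ₗ
      (opTensor H K).symm.toLinearMap

end Tensor

section TensorMap

variable (K₁ K₂ H₁ H₂ : Type*)
  [NormedAddCommGroup K₁] [InnerProductSpace ℂ K₁] [FiniteDimensional ℂ K₁]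
  [NormedAddCommGroup K₂] [InnerProductSpace ℂ K₂] [FiniteDimensional ℂ K₂]
  [NormedAddCommGroup H₁] [InnerProductSpace ℂ H₁] [FiniteDimensional ℂ H₁]
  [NormedAddCommGroup H₂] [InnerProductSpace ℂ H₂] [FiniteDimensional ℂ H₂]

/-- The canonical identification
`L(B(K₁), B(K₂)) ⊗ L(B(H₁), B(H₂)) ≃ L(B(K₁ ⊗ H₁), B(K₂ ⊗ H₂))`, which sends `Ψ ⊗ Φ` to the map
`A ⊗ B ↦ Ψ A ⊗ Φ B`. -/
def mapTensor :
    OpMap K₁ K₂ ⊗[ℂ] OpMap H₁ H₂ ≃ₗ[ℂ] OpMap (K₁ ⊗[ℂ] H₁) (K₂ ⊗[ℂ] H₂) :=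
  (homTensorHomEquiv ℂ (Op K₁) (Op H₁) (Op K₂) (Op H₂)).trans
    (LinearEquiv.arrowCongr (opTensor K₁ H₁) (opTensor K₂ H₂))

end TensorMap

section CP

variable {H K : Type*}
  [NormedAddCommGroup H] [InnerProductSpace ℂ H] [FiniteDimensional ℂ H]
  [NormedAddCommGroup K] [InnerProductSpace ℂ K] [FiniteDimensional ℂ K]

/-- A map `Φ : B(H) → B(K)` is completely positive if, for every `k`, the map
`id ⊗ Φ : M_k(ℂ) ⊗ B(H) → M_k(ℂ) ⊗ B(K)` sends positive elements to positive elements. Here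
`M_k(ℂ)` is `B(ℂ^k)`, and an element of `B(ℂ^k) ⊗ B(H)` is positive if it is a positive
semidefinite operator on `ℂ^k ⊗ H`. -/
def IsCP (Φ : OpMap H K) : Prop :=
  ∀ (k : ℕ) (X : Op (EuclideanSpace ℂ (Fin k)) ⊗[ℂ] Op H),
    (opTensor (EuclideanSpace ℂ (Fin k)) H X).IsPositive →
      (opTensor (EuclideanSpace ℂ (Fin k)) K
        (LinearMap.lTensor (Op (EuclideanSpace ℂ (Fin k))) Φ X)).IsPositive

end CP

section SuperMaps

variable {H₁ H₂ H₃ H₄ : Type*}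
  [NormedAddCommGroup H₁] [InnerProductSpace ℂ H₁] [FiniteDimensional ℂ H₁]
  [NormedAddCommGroup H₂] [InnerProductSpace ℂ H₂] [FiniteDimensional ℂ H₂]
  [NormedAddCommGroup H₃] [InnerProductSpace ℂ H₃] [FiniteDimensional ℂ H₃]
  [NormedAddCommGroup H₄] [InnerProductSpace ℂ H₄] [FiniteDimensional ℂ H₄]

/-- A super-map `Θ : L(B(H₁), B(H₂)) → L(B(H₃), B(H₄))` is completely CP-preserving if, for all
finite-dimensional Hilbert spaces `K₁` and `K₂`, the map `id ⊗ Θ` from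
`L(B(K₁), B(K₂)) ⊗ L(B(H₁), B(H₂))` to `L(B(K₁), B(K₂)) ⊗ L(B(H₃), B(H₄))` sends completely
positive maps `B(K₁ ⊗ H₁) → B(K₂ ⊗ H₂)` to completely positive maps
`B(K₁ ⊗ H₃) → B(K₂ ⊗ H₄)`. -/
def IsCompletelyCPPreserving (Θ : OpMap H₁ H₂ →ₗ[ℂ] OpMap H₃ H₄) : Prop :=
  ∀ (K₁ K₂ : Type w)
    [NormedAddCommGroup K₁] [InnerProductSpace ℂ K₁] [FiniteDimensional ℂ K₁]
    [NormedAddCommGroup K₂] [InnerProductSpace ℂ K₂] [FiniteDimensional ℂ K₂]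
    (Ψ : OpMap K₁ K₂ ⊗[ℂ] OpMap H₁ H₂),
    IsCP (mapTensor K₁ K₂ H₁ H₂ Ψ) →
      IsCP (mapTensor K₁ K₂ H₃ H₄ (LinearMap.lTensor (OpMap K₁ K₂) Θ Ψ))

/-- A super-map is a complete order isomorphism if it is invertible and both it and its inverse
are completely CP-preserving. -/
def IsCompleteOrderIso (Θ : OpMap H₁ H₂ →ₗ[ℂ] OpMap H₃ H₄) : Prop :=
  ∃ Ω : OpMap H₃ H₄ →ₗ[ℂ] OpMap H₁ H₂,
    Ω ∘ₗ Θ = LinearMap.id ∧ Θ ∘ₗ Ω = LinearMap.id ∧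
      IsCompletelyCPPreserving.{w} Θ ∧ IsCompletelyCPPreserving.{w} Ω

end SuperMaps

section Choi

variable {H K : Type*}
  [NormedAddCommGroup H] [InnerProductSpace ℂ H] [FiniteDimensional ℂ H]
  [NormedAddCommGroup K] [InnerProductSpace ℂ K] [FiniteDimensional ℂ K]
  {ι : Type*} [Fintype ι] (b : OrthonormalBasis ι ℂ H)

/-- The matrix unit `e i j = |b i⟩⟨b j|`, that is, `x ↦ ⟪b j, x⟫ • b i`. -/
def matrixUnit (i j : ι) : Op H :=
  (InnerProductSpace.rankOne ℂ (b i) (b j)).toLinearMap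

/-- The Choi matrix `∑ i, ∑ j, e i j ⊗ Φ (e i j)` of `Φ : B(H) → B(K)`, an operator on `H ⊗ K`,
with respect to the matrix units of the orthonormal basis `b` of `H`. -/
def choi (Φ : OpMap H K) : Op (H ⊗[ℂ] K) :=
  opTensor H K (∑ i, ∑ j, matrixUnit b i j ⊗ₜ[ℂ] Φ (matrixUnit b i j))

open Classical in
/-- The transpose of an operator with respect to the orthonormal basis `b`. -/
def transpose (A : Op H) : Op H :=
  Matrix.toLin b.toBasis b.toBasis (LinearMap.toMatrix b.toBasis b.toBasis A).transpose

end Choi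

end SuperMap

end

/-!
The proof treats `L(B(H), B(K))` through the maps `sandwich G G' : A ↦ G A G'†`. With respect to an
orthonormal basis `b` of `H`, an operator `G : H → K` has a vectorization `vec G ∈ H ⊗ K`, and the
Choi matrix of `sandwich G G'` is `|vec G⟩⟨vec G'|` (`choi_sandwich`). The partial trace formula
inverts the Choi correspondence (`partialTrace_transpose_comp_choi`), so the formula in the theorem
says that `Θ` acts on Choi matrices by `X ↦ K X K†` (`eq_partialTrace_iff_choi_eq`). A completely
positive map has a positive Choi matrix, which is a sum of operators `|u⟩⟨u|`; this gives its Kraus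
decomposition as a sum of maps `sandwich G G` (`IsCP.exists_eq_sum_sandwich`).

If `Θ` acts on Choi matrices by `X ↦ K X K†`, then `Θ (sandwich G G') = sandwich (κ G) (κ G')`, where
`κ` is the map `Hom(H₁, H₂) → Hom(H₃, H₄)` corresponding to `K` under vectorization. Then `id ⊗ Θ`
has the same form with `id ⊗ κ`, hence maps Kraus decompositions to Kraus decompositions; the same
applies to the inverse, which is given by `K⁻¹`.

Conversely, let `Θ` be a complete order isomorphism. Since `|v⟩⟨v|` is extremal among positive
operators, `sandwich G G` is extremal among completely positive maps, and `id ⊗ Θ` maps it to a map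
of the same form (`IsCompleteOrderIso.exists_mapTensor_lTensor_eq_sandwich`). This is applied to
the operator `∑ i, E i ⊗ F i`, where `E` and `F` are bases of `Hom(K₁, K₂)` and `Hom(H₁, H₂)`, and
`dim K₁ = dim H₁`, `dim K₂ = dim H₂`. The image is given by an operator `∑ i, E i ⊗ κ i`, and
comparing the coefficients of the independent maps `sandwich (E i) (E j)` gives
`Θ (sandwich (F i) (F j)) = sandwich (κ i) (κ j)`. The linear map `K` with `vec (F i) ↦ vec (κ i)`
therefore describes `Θ`, and it is bijective because `X ↦ K X K†` is.
-/

noncomputable section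

namespace SuperMap

open scoped InnerProductSpace

/-! ### Rank-one operators -/

section KetBra

variable {H K : Type*} [NormedAddCommGroup H] [InnerProductSpace ℂ H]
  [NormedAddCommGroup K] [InnerProductSpace ℂ K]

variable (H K) in
/-- The operator `|x⟩⟨y| : z ↦ ⟪y, z⟫ • x`, as a sesquilinear function of `x` and `y`. -/
def ketBra : H →ₗ[ℂ] K →ₗ⋆[ℂ] (K →ₗ[ℂ] H) :=
  LinearMap.mk₂'ₛₗ _ _ (fun x y => (InnerProductSpace.rankOne ℂ x y).toLinearMap)
    (fun _ _ _ => by ext; simp) (fun _ _ _ => by ext; simp)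
    (fun _ _ _ => by ext; simp) (fun _ _ _ => by ext; simp)

@[simp] lemma ketBra_apply (x : H) (y z : K) : ketBra H K x y z = ⟪y, z⟫_ℂ • x := rfl

lemma matrixUnit_eq_ketBra {ι : Type*} [Fintype ι] (b : OrthonormalBasis ι ℂ H) (i j : ι) :
    matrixUnit b i j = ketBra H H (b i) (b j) := rfl

lemma comp_ketBra_comp_adjoint {L M : Type*} [NormedAddCommGroup L] [InnerProductSpace ℂ L]
    [NormedAddCommGroup M] [InnerProductSpace ℂ M] [FiniteDimensional ℂ M]
    [FiniteDimensional ℂ K] (f : H →ₗ[ℂ] L) (g : K →ₗ[ℂ] M) (x : H) (y : K) :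
    f ∘ₗ ketBra H K x y ∘ₗ g.adjoint = ketBra L M (f x) (g y) := by
  ext z
  simp [LinearMap.adjoint_inner_right]

/-- Every operator is a sum of operators `|x⟩⟨y|`, since the identity is `∑ i, |b i⟩⟨b i|`. -/
lemma eq_sum_ketBra {ι : Type*} [Fintype ι] (b : OrthonormalBasis ι ℂ H) (X : Op H) :
    X = ∑ i, ketBra H H (X (b i)) (b i) := by
  ext z
  simp only [LinearMap.sum_apply, ketBra_apply, ← map_smul, ← map_sum]
  rw [b.sum_repr' z]

/-- The projection onto a line is extremal: if `∑ i, |u i⟩⟨u i| = |v⟩⟨v|`, then every `u i` is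
orthogonal to the orthogonal complement of `v`, hence a multiple of `v`. -/
lemma exists_smul_of_sum_ketBra_eq {ι : Type*} [Fintype ι] {u : ι → H} {v : H}
    (h : ∑ i, ketBra H H (u i) (u i) = ketBra H H v v) (i : ι) : ∃ a : ℂ, u i = a • v := by
  suffices u i ∈ (ℂ ∙ v) from (Submodule.mem_span_singleton.1 this).imp fun _ h => h.symm
  rw [← Submodule.orthogonal_orthogonal (ℂ ∙ v), Submodule.mem_orthogonal]
  intro x hx
  rw [Submodule.mem_orthogonal_singleton_iff_inner_right] at hx
  have h0 : ∑ j, ‖⟪u j, x⟫_ℂ‖ ^ 2 = 0 := by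
    have := congr(⟪x, $h x⟫_ℂ)
    simp only [LinearMap.sum_apply, ketBra_apply, hx, zero_smul, inner_zero_right, inner_sum,
      inner_smul_right] at this
    have h1 : ∀ j, ⟪u j, x⟫_ℂ * ⟪x, u j⟫_ℂ = ((‖⟪u j, x⟫_ℂ‖ ^ 2 : ℝ) : ℂ) := fun j => by
      rw [← inner_conj_symm x (u j), RCLike.mul_conj]; simp
    simp only [h1] at this
    exact_mod_cast this
  have := (Finset.sum_eq_zero_iff_of_nonneg fun _ _ => by positivity).1 h0 i (Finset.mem_univ _)
  rw [inner_eq_zero_symm]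
  simpa using this

variable [FiniteDimensional ℂ H] [FiniteDimensional ℂ K]

lemma opTensor_tmul (A : Op H) (B : Op K) :
    opTensor H K (A ⊗ₜ[ℂ] B) = TensorProduct.map A B := by
  simp [opTensor, homTensorHomEquiv_apply]

lemma opTensor_ketBra_tmul (x x' : H) (y y' : K) :
    opTensor H K (ketBra H H x x' ⊗ₜ[ℂ] ketBra K K y y') =
      ketBra (H ⊗[ℂ] K) (H ⊗[ℂ] K) (x ⊗ₜ y) (x' ⊗ₜ y') := by
  rw [opTensor_tmul]
  ext z w
  simp [TensorProduct.tmul_smul, TensorProduct.smul_tmul', smul_smul, mul_comm]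

lemma opTensor_comp (X Y : Op H) (Z W : Op K) :
    opTensor H K (X ⊗ₜ Z) ∘ₗ opTensor H K (Y ⊗ₜ W) = opTensor H K ((X ∘ₗ Y) ⊗ₜ (Z ∘ₗ W)) := by
  simp [opTensor_tmul, TensorProduct.map_comp]

@[simp] lemma partialTrace_opTensor_tmul (A : Op H) (B : Op K) :
    partialTrace H K (opTensor H K (A ⊗ₜ B)) = LinearMap.trace ℂ H A • B := by
  simp [partialTrace]


lemma isPositive_iff_eq_sum_ketBra {X : Op H} :
    X.IsPositive ↔ ∃ (m : ℕ) (u : Fin m → H), X = ∑ i, ketBra H H (u i) (u i) := by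
  have := FiniteDimensional.complete ℂ H
  rw [← LinearMap.isPositive_toContinuousLinearMap_iff,
    ContinuousLinearMap.isPositive_iff_eq_sum_rankOne]
  refine exists₂_congr fun m u => ?_
  constructor
  · intro h
    ext z
    simpa using congr($h z)
  · intro h
    ext z
    simp [h]

end KetBra

/-! ### The maps `A ↦ G A G'†` -/

section Sandwich

variable {H K : Type*}
  [NormedAddCommGroup H] [InnerProductSpace ℂ H] [FiniteDimensional ℂ H]
  [NormedAddCommGroup K] [InnerProductSpace ℂ K] [FiniteDimensional ℂ K]

variable (H K) in
/-- The map `A ↦ G A G'†`, as a sesquilinear function of `G` and `G'`. -/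
def sandwich : (H →ₗ[ℂ] K) →ₗ[ℂ] (H →ₗ[ℂ] K) →ₗ⋆[ℂ] OpMap H K :=
  LinearMap.mk₂'ₛₗ _ _
    (fun G G' =>
      { toFun := fun A => G ∘ₗ A ∘ₗ G'.adjoint
        map_add' := fun _ _ => by ext; simp
        map_smul' := fun _ _ => by ext; simp })
    (fun _ _ _ => by ext; simp) (fun _ _ _ => by ext; simp)
    (fun _ _ _ => by ext; simp) (fun _ _ _ => by ext; simp [map_smulₛₗ])

lemma sandwich_apply (G G' : H →ₗ[ℂ] K) (A : Op H) :
    sandwich H K G G' A = G ∘ₗ A ∘ₗ G'.adjoint := rfl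

lemma sandwich_smul_smul (a : ℂ) (G : H →ₗ[ℂ] K) :
    sandwich H K (a • G) (a • G) = ((‖a‖ ^ 2 : ℝ) : ℂ) • sandwich H K G G := by
  rw [LinearMap.map_smul, LinearMap.smul_apply, map_smulₛₗ, smul_smul, RCLike.mul_conj]
  simp

lemma opTensor_lTensor_sandwich {L : Type*} [NormedAddCommGroup L] [InnerProductSpace ℂ L]
    [FiniteDimensional ℂ L] (G G' : H →ₗ[ℂ] K) (X : Op L ⊗[ℂ] Op H) :
    opTensor L K (LinearMap.lTensor (Op L) (sandwich H K G G') X) =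
      TensorProduct.map LinearMap.id G ∘ₗ opTensor L H X ∘ₗ
        (TensorProduct.map LinearMap.id G' : L ⊗[ℂ] H →ₗ[ℂ] L ⊗[ℂ] K).adjoint := by
  induction X with
  | zero => simp
  | add X Y hX hY => simp only [map_add, hX, hY, LinearMap.add_comp, LinearMap.comp_add]
  | tmul A B =>
    simp only [LinearMap.lTensor_tmul, opTensor_tmul, sandwich_apply, TensorProduct.adjoint_map,
      ← TensorProduct.map_comp]
    simp

/-- A map with a Kraus decomposition is completely positive, since `id ⊗ (G · G†)` is conjugation
by `id ⊗ G`. -/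
lemma isCP_sum_sandwich {ι : Type*} [Fintype ι] (G : ι → H →ₗ[ℂ] K) :
    IsCP (∑ m, sandwich H K (G m) (G m)) := by
  intro k X hX
  simp only [← LinearMap.coe_lTensorHom, map_sum, LinearMap.sum_apply]
  simp only [LinearMap.coe_lTensorHom, opTensor_lTensor_sandwich]
  exact LinearMap.isPositive_sum _ fun m _ => hX.conj_adjoint _

lemma isCP_sandwich (G : H →ₗ[ℂ] K) : IsCP (sandwich H K G G) := by
  simpa using isCP_sum_sandwich fun _ : Unit => G

end Sandwich

/-! ### Vectorization and the Choi isomorphism -/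

section Vec

variable {H K : Type*} [NormedAddCommGroup H] [InnerProductSpace ℂ H]
  [NormedAddCommGroup K] [InnerProductSpace ℂ K]
  {ι : Type*} [Fintype ι] (b : OrthonormalBasis ι ℂ H)

variable (K) in
/-- Vectorization `Hom(H, K) ≃ H ⊗ K`, `G ↦ ∑ i, b i ⊗ G (b i)`. -/
def vec : (H →ₗ[ℂ] K) ≃ₗ[ℂ] H ⊗[ℂ] K :=
  letI := Classical.decEq ι
  (b.toBasis.constr ℂ).symm ≪≫ₗ (Finsupp.linearEquivFunOnFinite ℂ K ι).symm ≪≫ₗ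
    (TensorProduct.equivFinsuppOfBasisLeft b.toBasis).symm

lemma vec_apply (G : H →ₗ[ℂ] K) : vec K b G = ∑ i, b i ⊗ₜ G (b i) := by
  simp [vec, Finsupp.sum_fintype, Module.Basis.constr]

end Vec

section Choi

variable {H K : Type*}
  [NormedAddCommGroup H] [InnerProductSpace ℂ H] [FiniteDimensional ℂ H]
  [NormedAddCommGroup K] [InnerProductSpace ℂ K] [FiniteDimensional ℂ K]
  {ι : Type*} [Fintype ι] (b : OrthonormalBasis ι ℂ H)

lemma choi_sandwich (G G' : H →ₗ[ℂ] K) :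
    choi b (sandwich H K G G') = ketBra (H ⊗[ℂ] K) (H ⊗[ℂ] K) (vec K b G) (vec K b G') := by
  simp only [choi, matrixUnit_eq_ketBra, sandwich_apply, comp_ketBra_comp_adjoint, map_sum,
    opTensor_ketBra_tmul, vec_apply, LinearMap.sum_apply]
  exact Finset.sum_comm

lemma trace_transpose_comp_matrixUnit (A : Op H) (i j : ι) :
    LinearMap.trace ℂ H (transpose b A ∘ₗ matrixUnit b i j) = ⟪b i, A (b j)⟫_ℂ := by
  classical
  have : transpose b A ∘ₗ matrixUnit b i j =
      (InnerProductSpace.rankOne ℂ (transpose b A (b i)) (b j)).toLinearMap := by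
    ext; simp [matrixUnit]
  rw [this, InnerProductSpace.trace_rankOne, transpose, ← b.coe_toBasis, Matrix.toLin_self]
  simp [LinearMap.toMatrix_apply, inner_sum, inner_smul_right, b.inner_eq_ite,
    OrthonormalBasis.repr_apply_apply]

/-- A map is recovered from its Choi matrix. -/
lemma partialTrace_transpose_comp_choi (Φ : OpMap H K) (A : Op H) :
    partialTrace H K (opTensor H K (transpose b A ⊗ₜ LinearMap.id) ∘ₗ choi b Φ) = Φ A := by
  have hA : A = ∑ i, ∑ j, ⟪b i, A (b j)⟫_ℂ • matrixUnit b i j := by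
    conv_lhs => rw [eq_sum_ketBra b A]
    rw [Finset.sum_comm]
    refine Finset.sum_congr rfl fun j _ => ?_
    conv_lhs => rw [← b.sum_repr' (A (b j))]
    simp [matrixUnit_eq_ketBra]
  conv_rhs => rw [hA]
  simp only [choi, map_sum, ← Module.End.mul_eq_comp, Finset.mul_sum]
  simp only [Module.End.mul_eq_comp, opTensor_comp, partialTrace_opTensor_tmul,
    trace_transpose_comp_matrixUnit, map_smul, LinearMap.id_comp]

variable (K) in
/-- The Choi isomorphism `L(B(H), B(K)) ≃ B(H ⊗ K)`. It is onto because the Choi matrices of the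
maps `A ↦ G A G'†` are the operators `|x⟩⟨y|`. -/
def choiEquiv : OpMap H K ≃ₗ[ℂ] Op (H ⊗[ℂ] K) :=
  LinearEquiv.ofBijective
    { toFun := choi b
      map_add' := fun Φ Ψ => by
        simp [choi, TensorProduct.tmul_add, Finset.sum_add_distrib]
      map_smul' := fun c Φ => by
        simp [choi, Finset.smul_sum] }
    ⟨fun Φ Ψ h => LinearMap.ext fun A => by
        rw [← partialTrace_transpose_comp_choi b Φ, ← partialTrace_transpose_comp_choi b Ψ]
        exact congr(partialTrace H K (_ ∘ₗ $h)),
      by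
        rw [← LinearMap.range_eq_top, eq_top_iff]
        intro X _
        let d := stdOrthonormalBasis ℂ (H ⊗[ℂ] K)
        rw [eq_sum_ketBra d X]
        refine sum_mem fun i _ => ⟨sandwich H K ((vec K b).symm (X (d i))) ((vec K b).symm (d i)),
          (choi_sandwich b _ _).trans (by simp)⟩⟩

@[simp] lemma choiEquiv_apply (Φ : OpMap H K) : choiEquiv K b Φ = choi b Φ := rfl

lemma choiEquiv_symm_apply (X : Op (H ⊗[ℂ] K)) (A : Op H) :
    (choiEquiv K b).symm X A =
      partialTrace H K (opTensor H K (transpose b A ⊗ₜ LinearMap.id) ∘ₗ X) := by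
  rw [← partialTrace_transpose_comp_choi b, ← choiEquiv_apply, LinearEquiv.apply_symm_apply]

/-- The Choi matrix of a completely positive map is positive: it is the image of a multiple of the
projection onto a maximally entangled vector. -/
lemma IsCP.isPositive_choi {Φ : OpMap H K} (hΦ : IsCP Φ) : (choi b Φ).IsPositive := by
  let u : OrthonormalBasis ι ℂ (EuclideanSpace ℂ (Fin (Fintype.card ι))) :=
    (EuclideanSpace.basisFun (Fin (Fintype.card ι)) ℂ).reindex (Fintype.equivFin ι).symm
  let U : EuclideanSpace ℂ (Fin (Fintype.card ι)) →ₗ[ℂ] H :=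
    (u.equiv b (Equiv.refl ι)).toLinearEquiv.toLinearMap
  have hU : ∀ i, U (u i) = b i := fun i => by simp [U]
  have hX := hΦ _ (∑ i, ∑ j, matrixUnit u i j ⊗ₜ matrixUnit b i j) (by
    rw [isPositive_iff_eq_sum_ketBra]
    refine ⟨1, fun _ => ∑ i, u i ⊗ₜ b i, ?_⟩
    simp only [matrixUnit_eq_ketBra, map_sum, opTensor_ketBra_tmul, LinearMap.sum_apply]
    simpa using Finset.sum_comm)
  convert hX.conj_adjoint (TensorProduct.map U LinearMap.id)
  rw [← sandwich_apply]
  simp only [choi, map_sum, LinearMap.lTensor_tmul]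
  simp only [sandwich_apply, TensorProduct.adjoint_map, opTensor_tmul, ← TensorProduct.map_comp]
  simp only [matrixUnit_eq_ketBra, comp_ketBra_comp_adjoint, hU]
  simp

/-- Kraus decomposition: write the positive Choi matrix as `∑ i, |u i⟩⟨u i|` and read each `u i`
as the vectorization of an operator. -/
lemma IsCP.exists_eq_sum_sandwich {Φ : OpMap H K} (hΦ : IsCP Φ) :
    ∃ (m : ℕ) (G : Fin m → H →ₗ[ℂ] K), Φ = ∑ i, sandwich H K (G i) (G i) := by
  let b := stdOrthonormalBasis ℂ H
  obtain ⟨m, u, hu⟩ := isPositive_iff_eq_sum_ketBra.1 (hΦ.isPositive_choi b)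
  refine ⟨m, fun i => (vec K b).symm (u i), (choiEquiv K b).injective ?_⟩
  simp [choi_sandwich, hu]

/-- The map `A ↦ F A F†` spans an extremal ray of the cone of completely positive maps: the
operators in any Kraus decomposition of it are multiples of `F`. -/
lemma exists_smul_of_sum_sandwich_eq {κ : Type*} [Fintype κ] {G : κ → H →ₗ[ℂ] K}
    {F : H →ₗ[ℂ] K} (h : ∑ i, sandwich H K (G i) (G i) = sandwich H K F F) (i : κ) :
    ∃ a : ℂ, G i = a • F := by
  let b := stdOrthonormalBasis ℂ H
  have h' := congr(choiEquiv K b $h)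
  simp only [map_sum, choiEquiv_apply, choi_sandwich] at h'
  obtain ⟨a, ha⟩ := exists_smul_of_sum_ketBra_eq h' i
  exact ⟨a, (vec K b).injective (by simpa using ha)⟩

end Choi

/-! ### Tensor products of maps -/

section MapTensor

variable {K₁ K₂ H₁ H₂ : Type*}
  [NormedAddCommGroup K₁] [InnerProductSpace ℂ K₁] [FiniteDimensional ℂ K₁]
  [NormedAddCommGroup K₂] [InnerProductSpace ℂ K₂] [FiniteDimensional ℂ K₂]
  [NormedAddCommGroup H₁] [InnerProductSpace ℂ H₁] [FiniteDimensional ℂ H₁]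
  [NormedAddCommGroup H₂] [InnerProductSpace ℂ H₂] [FiniteDimensional ℂ H₂]

lemma mapTensor_sandwich_tmul (E E' : K₁ →ₗ[ℂ] K₂) (F F' : H₁ →ₗ[ℂ] H₂) :
    mapTensor K₁ K₂ H₁ H₂ (sandwich K₁ K₂ E E' ⊗ₜ sandwich H₁ H₂ F F') =
      sandwich (K₁ ⊗[ℂ] H₁) (K₂ ⊗[ℂ] H₂) (TensorProduct.map E F) (TensorProduct.map E' F') := by
  apply LinearMap.ext
  intro X
  obtain ⟨X, rfl⟩ := (opTensor K₁ H₁).surjective X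
  induction X with
  | zero => simp
  | add X Y hX hY => simp only [map_add, hX, hY]
  | tmul A B =>
    rw [mapTensor, LinearEquiv.trans_apply, LinearEquiv.arrowCongr_apply,
      LinearEquiv.symm_apply_apply, homTensorHomEquiv_apply, TensorProduct.homTensorHomMap_apply,
      TensorProduct.map_tmul]
    simp only [sandwich_apply, opTensor_tmul, TensorProduct.adjoint_map, TensorProduct.map_comp]

/-- The operator `∑ i, E i ⊗ F i` gives the map `∑ i, ∑ j, (E i · E j†) ⊗ (F i · F j†)`. -/
lemma mapTensor_sum_sandwich_tmul {ι : Type*} [Fintype ι] (E : ι → K₁ →ₗ[ℂ] K₂)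
    (F : ι → H₁ →ₗ[ℂ] H₂) :
    mapTensor K₁ K₂ H₁ H₂
        (∑ i, ∑ j, sandwich K₁ K₂ (E i) (E j) ⊗ₜ sandwich H₁ H₂ (F i) (F j)) =
      sandwich (K₁ ⊗[ℂ] H₁) (K₂ ⊗[ℂ] H₂) (∑ i, TensorProduct.map (E i) (F i))
        (∑ i, TensorProduct.map (E i) (F i)) := by
  simp only [map_sum, mapTensor_sandwich_tmul, LinearMap.sum_apply]
  exact Finset.sum_comm

end MapTensor

section OperatorTensor

variable {K₁ K₂ H₁ H₂ : Type*}
  [NormedAddCommGroup K₁] [InnerProductSpace ℂ K₁] [FiniteDimensional ℂ K₁]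
  [NormedAddCommGroup K₂] [InnerProductSpace ℂ K₂]
  [NormedAddCommGroup H₁] [InnerProductSpace ℂ H₁] [FiniteDimensional ℂ H₁]
  [NormedAddCommGroup H₂] [InnerProductSpace ℂ H₂]

/-- Every operator on a tensor product has the form `∑ i, E i ⊗ F i`, where `E` is any given basis
of the operators on the first factor. -/
lemma exists_eq_sum_map {ι : Type*} [Fintype ι] (E : Module.Basis ι ℂ (K₁ →ₗ[ℂ] K₂))
    (G : K₁ ⊗[ℂ] H₁ →ₗ[ℂ] K₂ ⊗[ℂ] H₂) :
    ∃ F : ι → H₁ →ₗ[ℂ] H₂, G = ∑ i, TensorProduct.map (E i) (F i) := by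
  classical
  obtain ⟨g, rfl⟩ := (homTensorHomEquiv ℂ K₁ H₁ K₂ H₂).surjective G
  obtain ⟨F, rfl⟩ := (TensorProduct.equivFinsuppOfBasisLeft E).symm.surjective g
  refine ⟨F, ?_⟩
  simp [Finsupp.sum_fintype, homTensorHomEquiv_apply]

end OperatorTensor

/-! ### Super-maps -/

section Congruence

variable {H₁ H₂ H₃ H₄ : Type*}
  [NormedAddCommGroup H₁] [InnerProductSpace ℂ H₁] [FiniteDimensional ℂ H₁]
  [NormedAddCommGroup H₂] [InnerProductSpace ℂ H₂] [FiniteDimensional ℂ H₂]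
  [NormedAddCommGroup H₃] [InnerProductSpace ℂ H₃] [FiniteDimensional ℂ H₃]
  [NormedAddCommGroup H₄] [InnerProductSpace ℂ H₄] [FiniteDimensional ℂ H₄]

/-- If `Θ (G · G'†) = κ G · (κ G')†` for a linear map `κ : Hom(H₁, H₂) → Hom(H₃, H₄)`, then
`id ⊗ Θ` has the same form, with `id ⊗ κ` in place of `κ`; so it preserves Kraus
decompositions. -/
lemma isCompletelyCPPreserving_of_sandwich {Θ : OpMap H₁ H₂ →ₗ[ℂ] OpMap H₃ H₄}
    (κ : (H₁ →ₗ[ℂ] H₂) →ₗ[ℂ] (H₃ →ₗ[ℂ] H₄))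
    (h : ∀ G G', Θ (sandwich H₁ H₂ G G') = sandwich H₃ H₄ (κ G) (κ G')) :
    IsCompletelyCPPreserving.{w} Θ := by
  intro K₁ K₂ _ _ _ _ _ _ Ψ hΨ
  obtain ⟨m, G, hG⟩ := hΨ.exists_eq_sum_sandwich
  let E := Module.finBasis ℂ (K₁ →ₗ[ℂ] K₂)
  choose F hF using fun i => exists_eq_sum_map (H₁ := H₁) (H₂ := H₂) E (G i)
  have hΨ' : Ψ = ∑ k, ∑ i, ∑ j,
      sandwich K₁ K₂ (E i) (E j) ⊗ₜ sandwich H₁ H₂ (F k i) (F k j) := by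
    apply (mapTensor K₁ K₂ H₁ H₂).injective
    rw [hG, map_sum]
    exact Finset.sum_congr rfl fun k _ => by rw [mapTensor_sum_sandwich_tmul, ← hF]
  have : mapTensor K₁ K₂ H₃ H₄ (LinearMap.lTensor (OpMap K₁ K₂) Θ Ψ) =
      ∑ k, sandwich (K₁ ⊗[ℂ] H₃) (K₂ ⊗[ℂ] H₄) (∑ i, TensorProduct.map (E i) (κ (F k i)))
        (∑ i, TensorProduct.map (E i) (κ (F k i))) := by
    simp only [← mapTensor_sum_sandwich_tmul, ← map_sum]
    simp only [hΨ', map_sum, LinearMap.lTensor_tmul, h]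
  rw [this]
  exact isCP_sum_sandwich _

variable {ι₁ ι₃ : Type*} [Fintype ι₁] [Fintype ι₃]
    (b₁ : OrthonormalBasis ι₁ ℂ H₁) (b₃ : OrthonormalBasis ι₃ ℂ H₃)

/-- The partial trace inverts the Choi isomorphism, so the formula with the partial trace says that
`Θ` acts on Choi matrices by `X ↦ K X K†`. -/
lemma eq_partialTrace_iff_choi_eq {Θ : OpMap H₁ H₂ →ₗ[ℂ] OpMap H₃ H₄}
    {K : H₁ ⊗[ℂ] H₂ →ₗ[ℂ] H₃ ⊗[ℂ] H₄} :
    (∀ Φ A, Θ Φ A = partialTrace H₃ H₄ (opTensor H₃ H₄ (transpose b₃ A ⊗ₜ LinearMap.id) ∘ₗ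
        K ∘ₗ choi b₁ Φ ∘ₗ K.adjoint)) ↔
      ∀ Φ, choi b₃ (Θ Φ) = sandwich (H₁ ⊗[ℂ] H₂) (H₃ ⊗[ℂ] H₄) K K (choi b₁ Φ) := by
  refine forall_congr' fun Φ => ?_
  simp only [← choiEquiv_symm_apply, ← sandwich_apply]
  rw [← LinearMap.ext_iff, LinearEquiv.eq_symm_apply, choiEquiv_apply]

lemma isCompletelyCPPreserving_of_choi_eq {Θ : OpMap H₁ H₂ →ₗ[ℂ] OpMap H₃ H₄}
    {K : H₁ ⊗[ℂ] H₂ →ₗ[ℂ] H₃ ⊗[ℂ] H₄}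
    (h : ∀ Φ, choi b₃ (Θ Φ) = sandwich (H₁ ⊗[ℂ] H₂) (H₃ ⊗[ℂ] H₄) K K (choi b₁ Φ)) :
    IsCompletelyCPPreserving.{w} Θ := by
  refine isCompletelyCPPreserving_of_sandwich
    ((vec H₄ b₃).symm.toLinearMap ∘ₗ K ∘ₗ (vec H₂ b₁).toLinearMap) fun G G' => ?_
  apply (choiEquiv H₄ b₃).injective
  simp [h, choi_sandwich, sandwich_apply, comp_ketBra_comp_adjoint]

/-- Conjugation by an invertible `K` on Choi matrices is inverted by conjugation by `K⁻¹`. -/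
lemma isCompleteOrderIso_of_choi_eq {Θ : OpMap H₁ H₂ →ₗ[ℂ] OpMap H₃ H₄}
    (K : H₁ ⊗[ℂ] H₂ ≃ₗ[ℂ] H₃ ⊗[ℂ] H₄)
    (h : ∀ Φ, choi b₃ (Θ Φ) =
      sandwich (H₁ ⊗[ℂ] H₂) (H₃ ⊗[ℂ] H₄) K.toLinearMap K.toLinearMap (choi b₁ Φ)) :
    IsCompleteOrderIso.{w} Θ := by
  let S := sandwich (H₁ ⊗[ℂ] H₂) (H₃ ⊗[ℂ] H₄) K.toLinearMap K.toLinearMap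
  let T := sandwich (H₃ ⊗[ℂ] H₄) (H₁ ⊗[ℂ] H₂) K.symm.toLinearMap K.symm.toLinearMap
  have hTS : ∀ X, T (S X) = X := fun X => by
    simp only [T, S, sandwich_apply, LinearMap.comp_assoc, ← LinearMap.adjoint_comp]
    simp [← LinearMap.comp_assoc]
  have hST : ∀ X, S (T X) = X := fun X => by
    simp only [T, S, sandwich_apply, LinearMap.comp_assoc, ← LinearMap.adjoint_comp]
    simp [← LinearMap.comp_assoc]
  let Ω : OpMap H₃ H₄ →ₗ[ℂ] OpMap H₁ H₂ :=
    (choiEquiv H₂ b₁).symm.toLinearMap ∘ₗ T ∘ₗ (choiEquiv H₄ b₃).toLinearMap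
  have hΩ : ∀ Φ, choi b₁ (Ω Φ) = T (choi b₃ Φ) := fun Φ => by
    simp [Ω, ← choiEquiv_apply]
  refine ⟨Ω, ?_, ?_, isCompletelyCPPreserving_of_choi_eq b₁ b₃ h,
    isCompletelyCPPreserving_of_choi_eq b₃ b₁ hΩ⟩
  · refine LinearMap.ext fun Φ => (choiEquiv H₂ b₁).injective ?_
    exact (hΩ _).trans ((congrArg T (h Φ)).trans (hTS _))
  · refine LinearMap.ext fun Φ => (choiEquiv H₄ b₃).injective ?_
    exact (h _).trans ((congrArg S (hΩ Φ)).trans (hST _))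

/-- `id ⊗ Θ`, being an order isomorphism, preserves the extremal rays spanned by the maps
`A ↦ G A G†`. -/
lemma IsCompleteOrderIso.exists_mapTensor_lTensor_eq_sandwich
    {Θ : OpMap H₁ H₂ →ₗ[ℂ] OpMap H₃ H₄} (hΘ : IsCompleteOrderIso.{w} Θ)
    {K₁ K₂ : Type w} [NormedAddCommGroup K₁] [InnerProductSpace ℂ K₁] [FiniteDimensional ℂ K₁]
    [NormedAddCommGroup K₂] [InnerProductSpace ℂ K₂] [FiniteDimensional ℂ K₂]
    {Ψ : OpMap K₁ K₂ ⊗[ℂ] OpMap H₁ H₂} {G : K₁ ⊗[ℂ] H₁ →ₗ[ℂ] K₂ ⊗[ℂ] H₂}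
    (hΨ : mapTensor K₁ K₂ H₁ H₂ Ψ = sandwich (K₁ ⊗[ℂ] H₁) (K₂ ⊗[ℂ] H₂) G G) :
    ∃ F : K₁ ⊗[ℂ] H₃ →ₗ[ℂ] K₂ ⊗[ℂ] H₄,
      mapTensor K₁ K₂ H₃ H₄ (LinearMap.lTensor (OpMap K₁ K₂) Θ Ψ) =
        sandwich (K₁ ⊗[ℂ] H₃) (K₂ ⊗[ℂ] H₄) F F := by
  obtain ⟨Ω, hΩΘ, hΘΩ, hΘ, hΩ⟩ := hΘ
  have hΩΘ' : ∀ X, LinearMap.lTensor (OpMap K₁ K₂) Ω (LinearMap.lTensor (OpMap K₁ K₂) Θ X) = X :=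
    fun X => by rw [← LinearMap.lTensor_comp_apply, hΩΘ, LinearMap.lTensor_id_apply]
  have hΘΩ' : ∀ X, LinearMap.lTensor (OpMap K₁ K₂) Θ (LinearMap.lTensor (OpMap K₁ K₂) Ω X) = X :=
    fun X => by rw [← LinearMap.lTensor_comp_apply, hΘΩ, LinearMap.lTensor_id_apply]
  obtain ⟨m, F, hF⟩ := (hΘ K₁ K₂ Ψ (hΨ ▸ isCP_sandwich G)).exists_eq_sum_sandwich
  -- Pull each Kraus term of the image back along `id ⊗ Ω` and decompose the result.
  let P k := (mapTensor K₁ K₂ H₃ H₄).symm (sandwich _ _ (F k) (F k))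
  have hP : ∑ k, LinearMap.lTensor (OpMap K₁ K₂) Ω (P k) = Ψ := by
    rw [← map_sum, ← map_sum, ← hF, LinearEquiv.symm_apply_apply, hΩΘ']
  have hPcp k : IsCP (mapTensor K₁ K₂ H₁ H₂ (LinearMap.lTensor (OpMap K₁ K₂) Ω (P k))) :=
    hΩ K₁ K₂ _ (by simpa [P] using isCP_sandwich (F k))
  choose n N hN using fun k => (hPcp k).exists_eq_sum_sandwich
  have hsum : ∑ x : (k : Fin m) × Fin (n k), sandwich _ _ (N x.1 x.2) (N x.1 x.2) =
      sandwich _ _ G G := by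
    rw [Fintype.sum_sigma, ← hΨ, ← hP, map_sum]
    exact Finset.sum_congr rfl fun k _ => (hN k).symm
  choose a ha using fun k i => exists_smul_of_sum_sandwich_eq hsum ⟨k, i⟩
  have hF' k : sandwich _ _ (F k) (F k) = ((∑ i, ‖a k i‖ ^ 2 : ℝ) : ℂ) •
      mapTensor K₁ K₂ H₃ H₄ (LinearMap.lTensor (OpMap K₁ K₂) Θ Ψ) := by
    have : LinearMap.lTensor (OpMap K₁ K₂) Ω (P k) = ((∑ i, ‖a k i‖ ^ 2 : ℝ) : ℂ) • Ψ := by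
      apply (mapTensor K₁ K₂ H₁ H₂).injective
      rw [hN k, map_smul, hΨ]
      simp only [ha, sandwich_smul_smul]
      rw [← Finset.sum_smul, Complex.ofReal_sum]
    rw [← map_smul, ← map_smul, ← this, hΘΩ', LinearEquiv.apply_symm_apply]
  by_cases h0 : ∀ k, (∑ i, ‖a k i‖ ^ 2 : ℝ) = 0
  -- If all the coefficients vanish, the image is zero; otherwise it is a rescaled Kraus term.
  · refine ⟨0, ?_⟩
    rw [hF, LinearMap.map_zero]
    exact Finset.sum_eq_zero fun k _ => by rw [hF' k, h0 k, Complex.ofReal_zero, zero_smul]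
  push Not at h0
  obtain ⟨k, hk⟩ := h0
  set c : ℝ := ∑ i, ‖a k i‖ ^ 2
  have hc : 0 < c := lt_of_le_of_ne (Finset.sum_nonneg fun _ _ => by positivity) hk.symm
  have hc' : ‖((√c)⁻¹ : ℂ)‖ ^ 2 = c⁻¹ := by
    rw [norm_inv, Complex.norm_of_nonneg (Real.sqrt_nonneg c), inv_pow, Real.sq_sqrt hc.le]
  refine ⟨((√c)⁻¹ : ℂ) • F k, ?_⟩
  rw [sandwich_smul_smul, hc', hF' k, smul_smul, ← Complex.ofReal_mul, inv_mul_cancel₀ hk,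
    Complex.ofReal_one, one_smul]

/-- For a family of `dim (H₁ ⊗ H₂)` operators `F i`, the super-map takes all the `F i · F j†` to
maps `κ i · κ j†`. This is read off from the action of `id ⊗ Θ` on the extremal map given by the
entangled operator `∑ i, E i ⊗ F i`, where `E` is a basis of the operators between auxiliary spaces
`K₁` and `K₂` of the dimensions of `H₁` and `H₂`. -/
lemma IsCompleteOrderIso.exists_sandwich
    {Θ : OpMap H₁ H₂ →ₗ[ℂ] OpMap H₃ H₄} (hΘ : IsCompleteOrderIso.{w} Θ)
    {n : ℕ} (hn : Module.finrank ℂ (H₁ ⊗[ℂ] H₂) = n) (F : Fin n → H₁ →ₗ[ℂ] H₂) :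
    ∃ κ : Fin n → H₃ →ₗ[ℂ] H₄,
      ∀ i j, Θ (sandwich H₁ H₂ (F i) (F j)) = sandwich H₃ H₄ (κ i) (κ j) := by
  -- Copies of `H₁` and `H₂` in the universe over which complete positivity is tested.
  let K₁ := EuclideanSpace ℂ (ULift.{w} (Fin (Module.finrank ℂ H₁)))
  let K₂ := EuclideanSpace ℂ (ULift.{w} (Fin (Module.finrank ℂ H₂)))
  have hK : Module.finrank ℂ (K₁ ⊗[ℂ] K₂) = n := by
    rw [← hn, Module.finrank_tensorProduct, Module.finrank_tensorProduct]
    simp [K₁, K₂]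
  let d : OrthonormalBasis (Fin n) ℂ (K₁ ⊗[ℂ] K₂) :=
    (stdOrthonormalBasis ℂ (K₁ ⊗[ℂ] K₂)).reindex (finCongr hK)
  let b := stdOrthonormalBasis ℂ K₁
  let E := d.toBasis.map (vec K₂ b).symm
  obtain ⟨G, hG⟩ := hΘ.exists_mapTensor_lTensor_eq_sandwich (mapTensor_sum_sandwich_tmul E F)
  obtain ⟨κ, rfl⟩ := exists_eq_sum_map E G
  refine ⟨κ, fun i j => ?_⟩
  rw [← mapTensor_sum_sandwich_tmul, (mapTensor K₁ K₂ H₃ H₄).injective.eq_iff] at hG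
  -- The functional `Ψ ↦ ⟪d i, C_Ψ (d j)⟫` isolates the term with indices `i` and `j`.
  let φ : OpMap K₁ K₂ →ₗ[ℂ] ℂ :=
    (innerₛₗ ℂ (d i)) ∘ₗ LinearMap.applyₗ (d j) ∘ₗ (choiEquiv K₂ b).toLinearMap
  have hφ k l : φ (sandwich K₁ K₂ (E k) (E l)) =
      (if l = j then 1 else 0) * if i = k then 1 else 0 := by
    rw [← d.inner_eq_ite, ← d.inner_eq_ite, ← inner_smul_right]
    simp [φ, E, choi_sandwich]
  have := congr(TensorProduct.lid ℂ _ (LinearMap.rTensor _ φ $hG))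
  simpa [hφ, ite_and] using this

/-- A complete order isomorphism acts on Choi matrices by conjugation with a linear map. -/
lemma IsCompleteOrderIso.exists_choi_eq
    {Θ : OpMap H₁ H₂ →ₗ[ℂ] OpMap H₃ H₄} (hΘ : IsCompleteOrderIso.{w} Θ) :
    ∃ K : H₁ ⊗[ℂ] H₂ →ₗ[ℂ] H₃ ⊗[ℂ] H₄, ∀ Φ, choi b₃ (Θ Φ) =
      sandwich (H₁ ⊗[ℂ] H₂) (H₃ ⊗[ℂ] H₄) K K (choi b₁ Φ) := by
  let d := stdOrthonormalBasis ℂ (H₁ ⊗[ℂ] H₂)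
  obtain ⟨κ, hκ⟩ := hΘ.exists_sandwich rfl fun i => (vec H₂ b₁).symm (d i)
  let K := d.toBasis.constr ℂ fun i => vec H₄ b₃ (κ i)
  have hK i : K (d i) = vec H₄ b₃ (κ i) := by
    rw [← d.coe_toBasis]
    exact d.toBasis.constr_basis ℂ _ i
  refine ⟨K, fun Φ => ?_⟩
  obtain ⟨X, rfl⟩ := (choiEquiv H₂ b₁).symm.surjective Φ
  have hX : X = ∑ j, ∑ i, ⟪d i, X (d j)⟫_ℂ • ketBra _ _ (d i) (d j) := by
    conv_lhs => rw [eq_sum_ketBra d X]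
    refine Finset.sum_congr rfl fun j _ => ?_
    conv_lhs => rw [← d.sum_repr' (X (d j))]
    simp
  have hd i j : ketBra _ _ (d i) (d j) =
      choiEquiv H₂ b₁ (sandwich H₁ H₂ ((vec H₂ b₁).symm (d i)) ((vec H₂ b₁).symm (d j))) := by
    simp [choi_sandwich]
  rw [← choiEquiv_apply, ← choiEquiv_apply, LinearEquiv.apply_symm_apply, hX]
  simp only [map_sum, map_smul]
  refine Finset.sum_congr rfl fun j _ => Finset.sum_congr rfl fun i _ => ?_
  congr 1
  rw [sandwich_apply, comp_ketBra_comp_adjoint, hd, LinearEquiv.symm_apply_apply, hκ,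
    choiEquiv_apply, choi_sandwich, hK, hK]

/-- If `X ↦ K X K†` is bijective, then so is `K`. -/
lemma bijective_of_bijective_sandwich {V W : Type*}
    [NormedAddCommGroup V] [InnerProductSpace ℂ V] [FiniteDimensional ℂ V]
    [NormedAddCommGroup W] [InnerProductSpace ℂ W] [FiniteDimensional ℂ W] {K : V →ₗ[ℂ] W}
    (h : Function.Bijective (sandwich V W K K)) : Function.Bijective K := by
  constructor
  · rw [injective_iff_map_eq_zero]
    intro x hx
    have h0 : ketBra V V x x = 0 := h.1 (by
      rw [sandwich_apply, comp_ketBra_comp_adjoint, hx]; simp)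
    simpa using congr($h0 x)
  · intro y
    -- If `K X K†` is the identity, then `X K†` is a right inverse of `K`.
    obtain ⟨X, hX⟩ := h.2 LinearMap.id
    exact ⟨_, congr($hX y)⟩

end Congruence

end SuperMap

end

theorem mainTheorem3
    {H₁ H₂ H₃ H₄ : Type*}
    [NormedAddCommGroup H₁] [InnerProductSpace ℂ H₁] [FiniteDimensional ℂ H₁]
    [NormedAddCommGroup H₂] [InnerProductSpace ℂ H₂] [FiniteDimensional ℂ H₂]
    [NormedAddCommGroup H₃] [InnerProductSpace ℂ H₃] [FiniteDimensional ℂ H₃]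
    [NormedAddCommGroup H₄] [InnerProductSpace ℂ H₄] [FiniteDimensional ℂ H₄]
    {ι₁ ι₃ : Type*} [Fintype ι₁] [Fintype ι₃]
    (b₁ : OrthonormalBasis ι₁ ℂ H₁) (b₃ : OrthonormalBasis ι₃ ℂ H₃)
    (Θ : SuperMap.OpMap H₁ H₂ →ₗ[ℂ] SuperMap.OpMap H₃ H₄) :
    SuperMap.IsCompleteOrderIso.{w} Θ ↔
      ∃ K : H₁ ⊗[ℂ] H₂ ≃ₗ[ℂ] H₃ ⊗[ℂ] H₄,
        ∀ (Φ : SuperMap.OpMap H₁ H₂) (A : SuperMap.Op H₃),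
          Θ Φ A =
            SuperMap.partialTrace H₃ H₄
              (SuperMap.opTensor H₃ H₄ (SuperMap.transpose b₃ A ⊗ₜ[ℂ] LinearMap.id) ∘ₗ
                K.toLinearMap ∘ₗ SuperMap.choi b₁ Φ ∘ₗ K.toLinearMap.adjoint) := by
  simp only [SuperMap.eq_partialTrace_iff_choi_eq b₁ b₃]
  refine ⟨fun hΘ => ?_, fun ⟨K, hK⟩ => SuperMap.isCompleteOrderIso_of_choi_eq b₁ b₃ K hK⟩
  obtain ⟨K, hK⟩ := hΘ.exists_choi_eq b₁ b₃
  obtain ⟨Ω, hΩΘ, hΘΩ, -, -⟩ := hΘ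
  let e : SuperMap.OpMap H₁ H₂ ≃ₗ[ℂ] SuperMap.OpMap H₃ H₄ := LinearEquiv.ofLinearMap Θ Ω hΘΩ hΩΘ
  have he : ⇑(SuperMap.sandwich (H₁ ⊗[ℂ] H₂) (H₃ ⊗[ℂ] H₄) K K) =
      ((SuperMap.choiEquiv H₂ b₁).symm ≪≫ₗ e ≪≫ₗ SuperMap.choiEquiv H₄ b₃) := by
    funext X
    obtain ⟨Φ, rfl⟩ := (SuperMap.choiEquiv H₂ b₁).surjective X
    rw [LinearEquiv.trans_apply, LinearEquiv.trans_apply, LinearEquiv.symm_apply_apply]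
    exact (hK Φ).symm
  exact ⟨LinearEquiv.ofBijective K
    (SuperMap.bijective_of_bijective_sandwich (he ▸ LinearEquiv.bijective _)), hK⟩
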